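/- Let $\mathbb{K}$ be a field, let $G$ be a finite simple graph with vertex set $\{v_1,\dots,v_n\}$, let $S=\mathbb{K}[x_1,\dots,x_n]$ with its standard $\mathbb{Z}^n$-grading, and let $I(G)\subseteq S$ be the edge ideal of $G$, generated by the monomials $x_ix_j$ with $\{v_i,v_j\}$ an edge of $G$. For a $\mathbb{Z}^n$-graded $S$-module $M$, a homogeneous element $u\in M$ and a set $Z\subseteq\{x_1,\dots,x_n\}$, the $\mathbb{K}$-subspace $u\mathbb{K}[Z]=\{uf : f\in\mathbb{K}[Z]\}$ of $M$ is called a Stanley space of dimension $|Z|$ if it is a free $\mathbb{K}[Z]$-module with basis $u$. A Stanley decomposition of $M$ is a decomposition of $M$, as a $\mathbb{K}$-vector space, into a finite direct sum of Stanley spaces; its Stanley depth is the minimum of the dimensions of these Stanley spaces. The Stanley depth $\operatorname{sdepth}(M)$ of a nonzero finitely generated $\mathbb{Z}^n$-graded module $M$ is the maximum of the Stanley depths of its Stanley decompositions. Suppose that $G$ is not bipartite, and let $p$ be the number of connected components of $G$ which are bipartite (an isolated vertex counts as a bipartite connected component). Then for every integer $k\geq 1$, $$\operatorname{sdepth}(I(G)^k)\geq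 p+1 .$$ -/

import Mathlib

noncomputable section

namespace StanleyDepth

/-- The edge ideal `I(G)` in `S = K[x_v : v ∈ V]`, generated by the monomials `x_v x_w` with
`{v, w}` an edge of `G`. -/
def edgeIdeal (K : Type*) [Field K] {V : Type*} (G : SimpleGraph V) : Ideal (MvPolynomial V K) :=
  Ideal.span {f | ∃ v w : V, G.Adj v w ∧ f = MvPolynomial.X v * MvPolynomial.X w}

/-- The number of connected components of `G` which (as graphs) are bipartite. An isolated vertex
is a bipartite connected component. -/
def numBipartiteComponents {V : Type*} (G : SimpleGraph V) : ℕ :=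
  Set.ncard {C : G.ConnectedComponent | C.toSimpleGraph.IsBipartite}

section Module

variable {K : Type*} [Field K] {V : Type*} {M : Type*} [AddCommGroup M] [Module K M]
  [Module (MvPolynomial V K) M] [IsScalarTower K (MvPolynomial V K) M]

/-- The `K`-linear map `S → M`, `f ↦ f u`. -/
def mulLeft (u : M) : MvPolynomial V K →ₗ[K] M :=
  (LinearMap.toSpanSingleton (MvPolynomial V K) M u).restrictScalars K

/-- The `K`-subspace `u K[Z]` of `M`, consisting of all `f u` with `f ∈ K[Z]`. -/
def stanleySpace (u : M) (Z : Finset V) : Submodule K M :=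
  (Subalgebra.toSubmodule (MvPolynomial.supported K (Z : Set V))).map (mulLeft u)

/-- A Stanley decomposition of the `S`-module `M`, graded by `ℤ^V` with components `𝓜 d`: finitely
many homogeneous elements `u i` and sets of variables `Z i`, such that each `u i K[Z i]` is a free
`K[Z i]`-module with basis `u i`, and `M` is the direct sum of these subspaces. -/
structure Decomposition (𝓜 : (V → ℤ) → Submodule K M) where
  /-- the number of Stanley spaces -/
  size : ℕ
  /-- the generators -/
  u : Fin size → M
  /-- the sets of variables -/
  Z : Fin size → Finset V
  homogeneous : ∀ i, ∃ d : V → ℤ, u i ∈ 𝓜 d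
  free : ∀ i, Set.InjOn (fun f : MvPolynomial V K => f • u i)
    (MvPolynomial.supported K (Z i : Set V) : Set (MvPolynomial V K))
  isInternal : DirectSum.IsInternal (fun i => stanleySpace (K := K) (u i) (Z i))

/-- The Stanley depth of a Stanley decomposition: the least dimension `|Z i|` of its Stanley
spaces (`⊤` if there are none, which happens only for the zero module). -/
def Decomposition.sdepth {𝓜 : (V → ℤ) → Submodule K M} (D : Decomposition 𝓜) : ℕ∞ :=
  ⨅ i, ((D.Z i).card : ℕ∞)

/-- The Stanley depth of a graded module: the largest Stanley depth of its Stanley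
decompositions. For finite `V` and `M ≠ 0` the supremum ranges over numbers `≤ |V|`. -/
def sdepth (𝓜 : (V → ℤ) → Submodule K M) : ℕ∞ :=
  ⨆ D : Decomposition 𝓜, D.sdepth

end Module

/-- The component of degree `d ∈ ℤ^V` of `S`: spanned by `x^d` if `d` is nonnegative, and zero
otherwise. -/
def ringComponent (K : Type*) [Field K] {V : Type*} (d : V → ℤ) :
    Submodule K (MvPolynomial V K) :=
  Submodule.span K {f | ∃ e : V →₀ ℕ, (∀ v, (e v : ℤ) = d v) ∧ f = MvPolynomial.monomial e 1}

/-- The degree `d` component `I ∩ S_d` of an ideal `I` of `S`; for a monomial ideal these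
components form its `ℤ^V`-grading. -/
def idealComponent {K : Type*} [Field K] {V : Type*} (I : Ideal (MvPolynomial V K)) (d : V → ℤ) :
    Submodule K I :=
  (ringComponent K d).comap ((Submodule.subtype I).restrictScalars K)

/-- The Stanley depth of a monomial ideal `I` of `S`, as a `ℤ^V`-graded `S`-module. -/
def idealSdepth {K : Type*} [Field K] {V : Type*} (I : Ideal (MvPolynomial V K)) : ℕ∞ :=
  sdepth (idealComponent I)

end StanleyDepth

end

/-!
The exponents of the monomials in `I(G)^k` are the vectors `a` that dominate a sum of `k` exponents
of edges. Group the vertices of `G` into blocks: the bipartite components, and the union of all the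
others. Then `a` is such an exponent iff `∑ i, t i a ≥ k`, where `t i a` is the largest number
`≤ k` of edges of the block `i`, with repetitions, whose exponents have a sum dominated by `a`.

On a bipartite block, `t i` is governed by Kőnig's theorem: a vertex cover of least weight can be
chosen so as to miss some vertex `v`, and increasing `a v` does not change the weight of that cover,
nor therefore `t i`. Choose such a direction `v` in each bipartite block, and any fixed vertex in
the remaining block. Two exponents lie in the same cell if the chosen directions agree, and so do
all the other coordinates, truncated at `k`. On a cell the sum of the `t i` can vary only through
the one coordinate chosen in the remaining block, so the part of a cell inside the ideal is closed
under infima. Hence it is an orthant, with all the chosen directions free, one for each block.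
-/

open Finset MvPolynomial
open scoped Pointwise

namespace StanleyDepth

section Orthants

variable {V : Type*}

/-- The exponents of the monomials of the Stanley space `x^m K[Z]`. -/
def orthant (m : V →₀ ℕ) (Z : Finset V) : Set (V →₀ ℕ) :=
  {a | m ≤ a ∧ ∀ v ∉ Z, a v = m v}

theorem self_mem_orthant (m : V →₀ ℕ) (Z : Finset V) : m ∈ orthant m Z :=
  ⟨le_rfl, fun _ _ => rfl⟩

theorem add_mem_orthant_iff {m d : V →₀ ℕ} {Z : Finset V} :
    m + d ∈ orthant m Z ↔ (d.support : Set V) ⊆ Z := by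
  simp only [orthant, Set.mem_ofPred_eq, le_self_add, true_and, Finsupp.add_apply,
    Nat.add_eq_left, Set.subset_def, mem_coe, Finsupp.mem_support_iff]
  exact forall_congr' fun v => not_imp_comm

/-- `A` is a disjoint union of finitely many orthants of dimension at least `n`: the combinatorial
shadow of a Stanley decomposition into spaces `x^m K[Z]` with `n ≤ |Z|`. -/
def HasOrthantPartition (n : ℕ) (A : Set (V →₀ ℕ)) : Prop :=
  ∃ P : Set ((V →₀ ℕ) × Finset V), P.Finite ∧ P.PairwiseDisjoint (fun p => orthant p.1 p.2) ∧
    ⋃ p ∈ P, orthant p.1 p.2 = A ∧ ∀ p ∈ P, n ≤ #p.2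

end Orthants

section MonomialIdeals

variable {K : Type*} [Field K] {V : Type*} {I : Ideal (MvPolynomial V K)}

theorem mem_supported_iff_forall_mem_support {f : MvPolynomial V K} {Z : Set V} :
    f ∈ supported K Z ↔ ∀ a ∈ f.support, (a.support : Set V) ⊆ Z := by
  simp only [mem_supported, Set.subset_def, mem_coe, mem_vars_iff_mem_support]
  grind

/-- The elements of the ideal `I` all of whose monomials have their exponents in `E`. -/
noncomputable def exponentsIn (I : Ideal (MvPolynomial V K)) (E : Set (V →₀ ℕ)) : Submodule K I :=
  (restrictSupport K E).comap ((Submodule.subtype I).restrictScalars K)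

theorem mem_exponentsIn {E : Set (V →₀ ℕ)} {f : I} :
    f ∈ exponentsIn I E ↔ ∀ a ∈ (f : MvPolynomial V K).support, a ∈ E :=
  Iff.rfl

theorem coe_mulLeft (u : I) (f : MvPolynomial V K) :
    ((mulLeft (K := K) u f : I) : MvPolynomial V K) = f * u :=
  rfl

theorem stanleySpace_monomial {m : V →₀ ℕ} (hm : monomial m 1 ∈ I) (Z : Finset V) :
    stanleySpace (K := K) (⟨monomial m 1, hm⟩ : I) Z = exponentsIn I (orthant m Z) := by
  classical
  ext f
  rw [mem_exponentsIn]
  constructor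
  · rintro ⟨g, hg, rfl⟩ a ha
    have hg' := mem_supported_iff_forall_mem_support.1 ((Subalgebra.mem_toSubmodule _).1 hg)
    rw [coe_mulLeft, mem_support_iff, coeff_mul_monomial', mul_one, ne_eq,
      ite_eq_right_iff, Classical.not_imp] at ha
    rw [← add_tsub_cancel_of_le ha.1, add_mem_orthant_iff]
    exact hg' _ (mem_support_iff.2 ha.2)
  · intro hf
    refine ⟨divMonomial (f : MvPolynomial V K) m, ?_, Subtype.ext ?_⟩
    · refine (Subalgebra.mem_toSubmodule _).2
        (mem_supported_iff_forall_mem_support.2 fun d hd => add_mem_orthant_iff.1 (hf _ ?_))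
      rwa [mem_support_iff, coeff_divMonomial, ← mem_support_iff] at hd
    · ext a
      rw [coe_mulLeft, coeff_mul_monomial', mul_one, coeff_divMonomial]
      split_ifs with hma
      · rw [add_tsub_cancel_of_le hma]
      · by_contra hne
        exact hma (hf a (mem_support_iff.2 (Ne.symm hne))).1

theorem iSupIndep_exponentsIn {J : Type*} {E : J → Set (V →₀ ℕ)}
    (hE : Pairwise fun i j => Disjoint (E i) (E j)) :
    iSupIndep fun j => exponentsIn I (E j) := by
  intro i
  rw [Submodule.disjoint_def]
  intro f hf hf'
  have hle : ⨆ j, ⨆ _ : j ≠ i, exponentsIn I (E j) ≤ exponentsIn I (⋃ j, ⋃ _ : j ≠ i, E j) :=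
    iSup₂_le fun j hj => Submodule.comap_mono <|
      restrictSupport_mono (R := K) (Set.subset_iUnion₂ (s := fun j _ => E j) j hj)
  rw [← Submodule.coe_eq_zero, ← support_eq_empty, eq_empty_iff_forall_notMem]
  intro a ha
  obtain ⟨j, hj, haj⟩ := Set.mem_iUnion₂.1 (mem_exponentsIn.1 (hle hf') a ha)
  exact Set.disjoint_left.1 (hE hj) haj (mem_exponentsIn.1 hf a ha)

theorem iSup_exponentsIn_eq_top {J : Type*} {E : J → Set (V →₀ ℕ)}
    (hI : ∀ f, f ∈ I ↔ ∀ a ∈ f.support, a ∈ ⋃ j, E j) :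
    ⨆ j, exponentsIn I (E j) = ⊤ := by
  refine eq_top_iff.2 fun f _ => ?_
  have hterm : ∀ a ∈ (f : MvPolynomial V K).support, a ∈ ⋃ j, E j := (hI f).1 f.2
  have hterm_mem (a) (ha : a ∈ (f : MvPolynomial V K).support) (r : K) : monomial a r ∈ I :=
    (hI _).2 fun b hb => (mem_singleton.1 (support_monomial_subset hb)) ▸ hterm a ha
  have hsum : f = ∑ a ∈ (f : MvPolynomial V K).support.attach,
      ⟨monomial a.1 (coeff a.1 (f : MvPolynomial V K)), hterm_mem a.1 a.2 _⟩ := by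
    refine Subtype.ext ?_
    rw [AddSubmonoidClass.coe_finsetSum,
      sum_attach _ fun a => monomial a (coeff a (f : MvPolynomial V K))]
    exact as_sum _
  rw [hsum]
  refine Submodule.sum_mem _ fun a _ => ?_
  obtain ⟨j, hj⟩ := Set.mem_iUnion.1 (hterm a.1 a.2)
  exact Submodule.mem_iSup_of_mem j <| mem_exponentsIn.2 fun b hb =>
    (mem_singleton.1 (support_monomial_subset hb)) ▸ hj

theorem le_idealSdepth_of_hasOrthantPartition {n : ℕ} {A : Set (V →₀ ℕ)}
    (hI : ∀ f, f ∈ I ↔ ∀ a ∈ f.support, a ∈ A) (hA : HasOrthantPartition n A) :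
    (n : ℕ∞) ≤ idealSdepth I := by
  obtain ⟨P, hP, hdisj, rfl, hn⟩ := hA
  have : Finite P := hP
  let e := (Finite.equivFin P).symm
  have hmem (p : P) : monomial p.1.1 (1 : K) ∈ I := (hI _).2 fun a ha =>
    mem_singleton.1 (support_monomial_subset ha) ▸
      Set.mem_biUnion p.2 (self_mem_orthant p.1.1 p.1.2)
  let D : Decomposition (idealComponent I) :=
    { size := Nat.card P
      u := fun j => ⟨monomial (e j).1.1 1, hmem (e j)⟩
      Z := fun j => (e j).1.2
      homogeneous := fun j =>
        ⟨fun v => (e j).1.1 v, Submodule.subset_span ⟨(e j).1.1, fun _ => rfl, rfl⟩⟩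
      free := fun j f _ g _ hfg =>
        mul_right_cancel₀ (monomial_eq_zero.not.2 one_ne_zero) (congrArg Subtype.val hfg)
      isInternal := by
        simp only [stanleySpace_monomial]
        refine DirectSum.isInternal_submodule_of_iSupIndep_of_iSup_eq_top
          (iSupIndep_exponentsIn fun i j hij =>
            hdisj (e i).2 (e j).2 fun h => hij (e.injective (Subtype.ext h)))
          (iSup_exponentsIn_eq_top ?_)
        rwa [e.surjective.iUnion_comp fun p : P => orthant p.1.1 p.1.2,
          ← Set.biUnion_eq_iUnion P fun p _ => orthant p.1 p.2] }
  exact le_iSup_of_le D (le_iInf fun j => Nat.cast_le.2 (hn _ (e j).2))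

end MonomialIdeals

section Matchings

variable {V : Type*} {E : Set (V →₀ ℕ)} {m n : ℕ} {a b : V →₀ ℕ}

/-- The vector `a` dominates a sum of `m` elements of `E`, with repetitions. For the exponents `E`
of the edges of a graph: there is a multiset of `m` edges containing each vertex `v` at most `a v`
times. -/
def HasMatching (E : Set (V →₀ ℕ)) (m : ℕ) (a : V →₀ ℕ) : Prop :=
  ∃ f : Fin m → V →₀ ℕ, (∀ i, f i ∈ E) ∧ ∑ i, f i ≤ a

theorem hasMatching_card {J : Type*} {s : Finset J} {f : J → V →₀ ℕ} (hf : ∀ j ∈ s, f j ∈ E)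
    (h : ∑ j ∈ s, f j ≤ a) : HasMatching E #s a :=
  ⟨fun i => f (s.equivFin.symm i), fun i => hf _ (s.equivFin.symm i).2, by
    rwa [s.equivFin.symm.sum_comp fun j => f j, sum_coe_sort]⟩

theorem HasMatching.mono (h : HasMatching E m a) (hab : a ≤ b) : HasMatching E m b :=
  let ⟨f, hf, hle⟩ := h
  ⟨f, hf, hle.trans hab⟩

theorem HasMatching.anti (h : HasMatching E n a) (hmn : m ≤ n) : HasMatching E m a := by
  obtain ⟨d, rfl⟩ := Nat.exists_eq_add_of_le hmn
  obtain ⟨f, hf, hle⟩ := h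
  rw [Fin.sum_univ_add] at hle
  exact ⟨fun i => f (Fin.castAdd d i), fun _ => hf _, le_self_add.trans hle⟩

theorem HasMatching.le_sum_of_forall_exists_mem (h : HasMatching E m a) {C : Finset V}
    (hC : ∀ e ∈ E, ∃ v ∈ C, e v ≠ 0) : m ≤ ∑ v ∈ C, a v := by
  obtain ⟨f, hf, hle⟩ := h
  have hpos (i : Fin m) : 1 ≤ ∑ v ∈ C, f i v := by
    obtain ⟨v, hv, hne⟩ := hC _ (hf i)
    exact (Nat.one_le_iff_ne_zero.2 hne).trans (single_le_sum_of_canonicallyOrdered hv)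
  calc m = ∑ _i : Fin m, 1 := by simp
    _ ≤ ∑ i, ∑ v ∈ C, f i v := sum_le_sum fun i _ => hpos i
    _ = ∑ v ∈ C, (∑ i, f i) v := by
      rw [sum_comm]
      exact sum_congr rfl fun v _ => (Finsupp.finsetSum_apply ..).symm
    _ ≤ ∑ v ∈ C, a v := sum_le_sum fun v _ => hle v

theorem span_monomial_pow {K : Type*} [Field K] (E : Set (V →₀ ℕ)) (k : ℕ) :
    Ideal.span ((fun e => monomial e (1 : K)) '' E) ^ k =
      Ideal.span ((fun e => monomial e (1 : K)) ''
        {b | ∃ f : Fin k → V →₀ ℕ, (∀ i, f i ∈ E) ∧ ∑ i, f i = b}) := by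
  rw [Ideal.span, Submodule.span_pow]
  congr 1
  ext p
  rw [Set.mem_pow_iff_prod]
  constructor
  · rintro ⟨g, hg, rfl⟩
    choose f hf hfg using hg
    exact ⟨∑ i, f i, ⟨f, hf, rfl⟩, by simp [monomial_sum_one, hfg]⟩
  · rintro ⟨_, ⟨f, hf, rfl⟩, rfl⟩
    exact ⟨_, fun i => Set.mem_image_of_mem _ (hf i), (monomial_sum_one univ f).symm⟩

theorem mem_span_monomial_pow_iff {K : Type*} [Field K] {k : ℕ} {p : MvPolynomial V K} :
    p ∈ Ideal.span ((fun e => monomial e (1 : K)) '' E) ^ k ↔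
      ∀ a ∈ p.support, HasMatching E k a := by
  rw [span_monomial_pow, mem_ideal_span_monomial_image]
  refine forall₂_congr fun a _ => ⟨?_, ?_⟩
  · rintro ⟨_, ⟨f, hf, rfl⟩, hle⟩
    exact ⟨f, hf, hle⟩
  · rintro ⟨f, hf, hle⟩
    exact ⟨_, ⟨f, hf, rfl⟩, hle⟩

end Matchings

section EdgeExponents

variable {V : Type*} {G : SimpleGraph V} {e : V →₀ ℕ}

/-- The exponents of the generators `x_v x_w` of the edge ideal of `G`. -/
def edgeExponents (G : SimpleGraph V) : Set (V →₀ ℕ) :=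
  {e | ∃ v w, G.Adj v w ∧ e = Finsupp.single v 1 + Finsupp.single w 1}

theorem apply_le_one_of_mem_edgeExponents (he : e ∈ edgeExponents G) (x : V) : e x ≤ 1 := by
  classical
  obtain ⟨v, w, hvw, rfl⟩ := he
  have := hvw.ne
  simp only [Finsupp.add_apply, Finsupp.single_apply]
  grind

theorem exists_adj_of_mem_edgeExponents (he : e ∈ edgeExponents G) {v : V} (hv : e v ≠ 0) :
    ∃ w, G.Adj v w := by
  classical
  obtain ⟨x, y, hxy, rfl⟩ := he
  simp only [Finsupp.add_apply, Finsupp.single_apply] at hv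
  grind [SimpleGraph.Adj.symm]

theorem edgeIdeal_eq_span_monomial (K : Type*) [Field K] (G : SimpleGraph V) :
    edgeIdeal K G = Ideal.span ((fun e => monomial e (1 : K)) '' edgeExponents G) := by
  have hXX (v w : V) : (X v * X w : MvPolynomial V K) =
      monomial (Finsupp.single v 1 + Finsupp.single w 1) 1 := by simp [X]
  unfold edgeIdeal
  congr 1
  ext p
  simp only [edgeExponents, hXX]
  grind

theorem mem_edgeIdeal_pow_iff {K : Type*} [Field K] {k : ℕ} {p : MvPolynomial V K} :
    p ∈ edgeIdeal K G ^ k ↔ ∀ a ∈ p.support, HasMatching (edgeExponents G) k a := by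
  rw [edgeIdeal_eq_span_monomial, mem_span_monomial_pow_iff]

end EdgeExponents

section Truncation

variable {V β : Type*} {N : ℕ} {S : Set V} {a b : V →₀ ℕ}

/-- The vectors `a` and `b` have the same truncations at `N` on the set `S`. -/
def TruncEqOn (N : ℕ) (S : Set V) (a b : V →₀ ℕ) : Prop :=
  ∀ v ∈ S, min (a v) N = min (b v) N

theorem TruncEqOn.symm (h : TruncEqOn N S a b) : TruncEqOn N S b a :=
  fun v hv => (h v hv).symm

theorem TruncEqOn.add_right (h : TruncEqOn N S a b) (d : V →₀ ℕ) :
    TruncEqOn N S (a + d) (b + d) := by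
  intro v hv
  have := h v hv
  simp only [Finsupp.add_apply]
  omega

theorem truncEqOn_add_single_of_le {w : V} (hle : a ≤ b)
    (h : ∀ v ∈ S, v ≠ w → min (a v) N = min (b v) N) :
    TruncEqOn N S (a + Finsupp.single w (b w - a w)) b := by
  intro v hv
  by_cases hvw : v = w
  · subst hvw
    rw [Finsupp.add_apply, Finsupp.single_eq_same, add_tsub_cancel_of_le (hle v)]
  · rw [Finsupp.add_apply, Finsupp.single_eq_of_ne hvw, add_zero, h v hv hvw]

/-- The value of `t` depends only on the coordinates in `S`, truncated at `N`. -/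
def IsLocal (N : ℕ) (S : Set V) (t : (V →₀ ℕ) → β) : Prop :=
  ∀ ⦃a b⦄, TruncEqOn N S a b → t a = t b

/-- The directions in `S` along which `t` stays constant from `a` on. -/
def flatDirections (t : (V →₀ ℕ) → β) (S : Set V) (a : V →₀ ℕ) : Set V :=
  {v | v ∈ S ∧ ∀ n, t (a + Finsupp.single v n) = t a}

theorem IsLocal.flatDirections_congr {t : (V →₀ ℕ) → β} (ht : IsLocal N S t)
    (h : TruncEqOn N S a b) : flatDirections t S a = flatDirections t S b := by
  ext v
  refine and_congr_right fun _ => forall_congr' fun n => ?_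
  rw [ht (h.add_right _), ht h]

theorem flatDirections_add_single {t : (V →₀ ℕ) → ℕ} (ht : Monotone t) {v : V}
    (hv : v ∈ flatDirections t S a) (n : ℕ) :
    flatDirections t S (a + Finsupp.single v n) ⊆ flatDirections t S a ∧
      v ∈ flatDirections t S (a + Finsupp.single v n) := by
  refine ⟨fun w hw => ⟨hw.1, fun l => le_antisymm ?_ (ht le_self_add)⟩, hv.1, fun l => ?_⟩
  · calc t (a + Finsupp.single w l)
        ≤ t (a + Finsupp.single v n + Finsupp.single w l) := ht (by gcongr; exact le_self_add)
      _ = t a := by rw [hw.2, hv.2]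
  · rw [add_assoc, ← Finsupp.single_add, hv.2, hv.2]

/-- A choice, at each point, of a coordinate direction in `S`, which depends only on the
coordinates in `S`, truncated at `N`, and does not change when moving along the chosen direction. -/
structure IsDirectionField (N : ℕ) (S : Set V) (σ : (V →₀ ℕ) → V) : Prop where
  mem : ∀ a, σ a ∈ S
  isLocal : IsLocal N S σ
  stable : ∀ a n, σ (a + Finsupp.single (σ a) n) = σ a

theorem isDirectionField_const {v : V} (hv : v ∈ S) : IsDirectionField N S fun _ => v :=
  ⟨fun _ => hv, fun _ _ _ => rfl, fun _ _ => rfl⟩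

-- The direction chosen at `a` is the least flat one, for some well-order on `V`.
theorem exists_isDirectionField_mem_flatDirections {t : (V →₀ ℕ) → ℕ} (hmono : Monotone t)
    (hloc : IsLocal N S t) (hflat : ∀ a, (flatDirections t S a).Nonempty) :
    ∃ σ, IsDirectionField N S σ ∧ ∀ a, σ a ∈ flatDirections t S a := by
  obtain ⟨_, _⟩ := exists_wellFoundedLT V
  let least (D : {D : Set V // D.Nonempty}) : V := wellFounded_lt.min D.1 D.2
  have least_mem (D) : least D ∈ D.1 := WellFounded.min_mem ..
  have least_le (D) {v : V} (hv : v ∈ D.1) : least D ≤ v :=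
    not_lt.1 (WellFounded.not_lt_min _ _ hv)
  refine ⟨fun a => least ⟨_, hflat a⟩, ⟨fun a => (least_mem ⟨_, hflat a⟩).1,
    fun a b hab => ?_, fun a n => ?_⟩, fun a => least_mem ⟨_, hflat a⟩⟩
  · exact congrArg least (Subtype.ext (hloc.flatDirections_congr hab))
  · obtain ⟨hsub, hmem⟩ := flatDirections_add_single hmono (least_mem ⟨_, hflat a⟩) n
    exact le_antisymm (least_le _ hmem) (least_le _ (hsub (least_mem ⟨_, hflat _⟩)))

end Truncation

section Cells

variable {V ι : Type*} {N : ℕ} {c : V → ι} {σ : ι → (V →₀ ℕ) → V} {a b d m : V →₀ ℕ}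

/-- The relation whose classes are the cells into which the direction fields `σ i`, one on each
block `c ⁻¹' {i}`, divide the exponents: the chosen directions agree, and so do all coordinates,
truncated at `N`, except those in the chosen directions. -/
def SameCell (N : ℕ) (c : V → ι) (σ : ι → (V →₀ ℕ) → V) (a b : V →₀ ℕ) : Prop :=
  (∀ i, σ i a = σ i b) ∧ ∀ v, v ≠ σ (c v) a → min (a v) N = min (b v) N

theorem SameCell.refl (a : V →₀ ℕ) : SameCell N c σ a a :=
  ⟨fun _ => rfl, fun _ _ => rfl⟩

theorem SameCell.symm (h : SameCell N c σ a b) : SameCell N c σ b a :=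
  ⟨fun i => (h.1 i).symm, fun v hv => (h.2 v (by rwa [h.1])).symm⟩

theorem SameCell.trans (h : SameCell N c σ a b) (h' : SameCell N c σ b d) : SameCell N c σ a d :=
  ⟨fun i => (h.1 i).trans (h'.1 i), fun v hv => (h.2 v hv).trans (h'.2 v (by rwa [← h.1]))⟩

theorem SameCell.inf_truncEqOn (h : SameCell N c σ a b) (i : ι) :
    TruncEqOn N (c ⁻¹' {i}) (a ⊓ b) a ∨ TruncEqOn N (c ⁻¹' {i}) (a ⊓ b) b := by
  refine (le_total (a (σ i a)) (b (σ i a))).imp ?_ ?_ <;> rintro hle v rfl <;>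
    have := h.2 v <;> rw [Finsupp.inf_apply] <;> grind

theorem SameCell.inf (hσ : ∀ i, IsLocal N (c ⁻¹' {i}) (σ i)) (h : SameCell N c σ a b) :
    SameCell N c σ (a ⊓ b) a := by
  have hdir (i : ι) : σ i (a ⊓ b) = σ i a :=
    (h.inf_truncEqOn i).elim (fun ha => hσ i ha) fun hb => (hσ i hb).trans (h.1 i).symm
  refine ⟨hdir, fun v hv => ?_⟩
  have := h.2 v (by rwa [← hdir])
  rw [Finsupp.inf_apply]
  grind

theorem sameCell_of_truncEqOn (hσ : ∀ i, IsLocal N (c ⁻¹' {i}) (σ i))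
    (h : TruncEqOn N Set.univ a b) : SameCell N c σ a b :=
  ⟨fun i => hσ i fun v _ => h v trivial, fun v _ => h v trivial⟩

theorem SameCell.apply_eq_of_le {β : Type*} {t : (V →₀ ℕ) → β} {i : ι}
    (ht : IsLocal N (c ⁻¹' {i}) t) (hflat : σ i a ∈ flatDirections t (c ⁻¹' {i}) a)
    (h : SameCell N c σ a b) (hle : a ≤ b) : t a = t b :=
  calc t a = t (a + Finsupp.single (σ i a) (b (σ i a) - a (σ i a))) := (hflat.2 _).symm
    _ = t b := ht <| truncEqOn_add_single_of_le hle <| by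
      rintro v rfl hv
      exact h.2 v hv

variable [Finite V]

/-- The free directions of the orthant with vertex `m` that is contained in the cell of `m`. -/
noncomputable def cellDirections (N : ℕ) (c : V → ι) (σ : ι → (V →₀ ℕ) → V) (m : V →₀ ℕ) :
    Finset V :=
  (Set.toFinite {v | v = σ (c v) m ∨ N ≤ m v}).toFinset

theorem mem_cellDirections {v : V} : v ∈ cellDirections N c σ m ↔ v = σ (c v) m ∨ N ≤ m v :=
  Set.Finite.mem_toFinset _

theorem card_le_card_cellDirections [Fintype ι] (hσ : ∀ i a, c (σ i a) = i) (m : V →₀ ℕ) :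
    Fintype.card ι ≤ #(cellDirections N c σ m) :=
  card_le_card_of_injOn (fun i => σ i m)
    (fun i _ => mem_cellDirections.2 (Or.inl (by rw [hσ])))
    fun i _ j _ hij => by
      rw [← hσ i m, ← hσ j m]
      exact congrArg c hij

theorem mem_orthant_cellDirections_iff (hσ : ∀ i, IsDirectionField N (c ⁻¹' {i}) (σ i)) :
    a ∈ orthant m (cellDirections N c σ m) ↔ m ≤ a ∧ SameCell N c σ m a := by
  refine and_congr_right fun hle => ⟨fun ha => ?_, fun h v hv => ?_⟩
  · have hoff (v : V) (hv : v ≠ σ (c v) m) : min (m v) N = min (a v) N := by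
      have := hle v
      have := ha v
      have := mem_cellDirections (N := N) (c := c) (σ := σ) (m := m) (v := v)
      grind
    refine ⟨fun i => ?_, hoff⟩
    rw [← (hσ i).stable m (a (σ i m) - m (σ i m))]
    refine (hσ i).isLocal (truncEqOn_add_single_of_le hle ?_)
    rintro v rfl hv
    exact hoff v hv
  · rw [mem_cellDirections, not_or] at hv
    have := h.2 v hv.1
    omega

end Cells

section Partition

variable {V ι : Type*} [Finite V] {N : ℕ} {c : V → ι}

theorem exists_isLeast_of_infClosed {α : Type*} [SemilatticeInf α] [WellFoundedLT α] {s : Set α}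
    (hs : InfClosed s) (hne : s.Nonempty) : ∃ x, IsLeast s x := by
  obtain ⟨x, hx, hmin⟩ := wellFounded_lt.has_min s hne
  exact ⟨x, hx, fun y hy => inf_eq_left.1 <|
    inf_le_left.eq_of_not_lt (hmin _ (hs hx hy))⟩

/-- The cells, restricted to `A`, are closed under infima, so each of them is the orthant at its
least element. -/
theorem hasOrthantPartition_of_inf_mem [Fintype ι] {σ : ι → (V →₀ ℕ) → V}
    (hσ : ∀ i, IsDirectionField N (c ⁻¹' {i}) (σ i)) {A : Set (V →₀ ℕ)} (hA : IsUpperSet A)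
    (hloc : IsLocal N Set.univ (· ∈ A))
    (hinf : ∀ a ∈ A, ∀ b ∈ A, SameCell N c σ a b → a ⊓ b ∈ A) :
    HasOrthantPartition (Fintype.card ι) A := by
  classical
  have hσloc (i : ι) := (hσ i).isLocal
  let minimal : Set (V →₀ ℕ) := {m | IsLeast {a | a ∈ A ∧ SameCell N c σ m a} m}
  have hminimal : minimal.Finite := by
    refine (Set.finite_Iic (Finsupp.equivFunOnFinite.symm fun _ : V => N)).subset fun m hm => ?_
    have htrunc : TruncEqOn N Set.univ m
        (m ⊓ Finsupp.equivFunOnFinite.symm fun _ : V => N) := fun v _ => by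
      simp [Finsupp.inf_apply]
    exact inf_eq_left.1 <| inf_le_left.antisymm <|
      hm.2 ⟨(hloc htrunc).mp hm.1.1, sameCell_of_truncEqOn hσloc htrunc⟩
  refine ⟨(fun m => (m, cellDirections N c σ m)) '' minimal, hminimal.image _, ?_, ?_, ?_⟩
  · rintro _ ⟨m, hm, rfl⟩ _ ⟨m', hm', rfl⟩ hne
    refine Set.disjoint_left.2 fun a ha ha' => hne ?_
    have hcell := ((mem_orthant_cellDirections_iff hσ).1 ha).2.trans
      ((mem_orthant_cellDirections_iff hσ).1 ha').2.symm
    rw [(hm.2 ⟨hm'.1.1, hcell⟩).antisymm (hm'.2 ⟨hm.1.1, hcell.symm⟩)]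
  · rw [Set.biUnion_image]
    refine (Set.iUnion₂_subset fun m hm a ha => hA ha.1 hm.1.1).antisymm fun a ha => ?_
    obtain ⟨m, ⟨hmA, ham⟩, hm⟩ := exists_isLeast_of_infClosed
      (s := {b | b ∈ A ∧ SameCell N c σ a b})
      (fun b hb d hd => ⟨hinf b hb.1 d hd.1 (hb.2.symm.trans hd.2),
        hb.2.trans ((hb.2.symm.trans hd.2).inf hσloc).symm⟩)
      ⟨a, ha, .refl a⟩
    exact Set.mem_biUnion (x := m)
      ⟨⟨hmA, .refl m⟩, fun b hb => hm ⟨hb.1, ham.trans hb.2⟩⟩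
      ((mem_orthant_cellDirections_iff hσ).2 ⟨hm ⟨ha, .refl a⟩, ham.symm⟩)
  · rintro _ ⟨m, -, rfl⟩
    exact card_le_card_cellDirections (fun i a => (hσ i).mem a) m

theorem hasOrthantPartition_le_sum [Fintype ι] {t : ι → (V →₀ ℕ) → ℕ} (k : ℕ)
    (hmono : ∀ i, Monotone (t i)) (hloc : ∀ i, IsLocal N (c ⁻¹' {i}) (t i)) {v₀ : V}
    (hflat : ∀ i ≠ c v₀, ∀ a, (flatDirections (t i) (c ⁻¹' {i}) a).Nonempty) :
    HasOrthantPartition (Fintype.card ι) {a | k ≤ ∑ i, t i a} := by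
  have hfield (i : ι) : ∃ σ, IsDirectionField N (c ⁻¹' {i}) σ ∧
      (i ≠ c v₀ → ∀ a, σ a ∈ flatDirections (t i) (c ⁻¹' {i}) a) := by
    by_cases hi : i = c v₀
    · exact ⟨_, isDirectionField_const hi.symm, absurd hi⟩
    · obtain ⟨σ, hσ, hmem⟩ :=
        exists_isDirectionField_mem_flatDirections (hmono i) (hloc i) (hflat i hi)
      exact ⟨σ, hσ, fun _ => hmem⟩
  choose σ hσ hmem using hfield
  have hσloc (i : ι) := (hσ i).isLocal
  refine hasOrthantPartition_of_inf_mem hσ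
    (fun a b hab ha => ha.trans (sum_le_sum fun i _ => hmono i hab))
    (fun a b hab => ?_) fun a ha b hb hab => ?_
  · have hsum : ∑ i, t i a = ∑ i, t i b :=
      sum_congr rfl fun i _ => hloc i fun v _ => hab v trivial
    simp only [Set.mem_ofPred_eq, hsum]
  · have hsum {d : V →₀ ℕ} (hle : a ⊓ b ≤ d) (hcell : SameCell N c σ (a ⊓ b) d)
        (h₀ : TruncEqOn N (c ⁻¹' {c v₀}) (a ⊓ b) d) : ∑ i, t i (a ⊓ b) = ∑ i, t i d := by
      refine sum_congr rfl fun i _ => ?_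
      by_cases hi : i = c v₀
      · subst hi
        exact hloc _ h₀
      · exact hcell.apply_eq_of_le (hloc i) (hmem i hi _) hle
    have hcell := hab.inf hσloc
    rcases hab.inf_truncEqOn (c v₀) with h₀ | h₀
    · exact ha.trans_eq (hsum inf_le_left hcell h₀).symm
    · exact hb.trans_eq (hsum inf_le_right (hcell.trans hab) h₀).symm

end Partition

section MatchingOrder

variable {V ι : Type*} {E : Set (V →₀ ℕ)} {k m N : ℕ} {a b : V →₀ ℕ}

theorem hasMatching_zero (E : Set (V →₀ ℕ)) (a : V →₀ ℕ) : HasMatching E 0 a :=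
  ⟨Fin.elim0, fun i => i.elim0, by simp⟩

open Classical in
/-- The largest `m ≤ k` for which `a` dominates a sum of `m` elements of `E`. -/
noncomputable def matchingOrder (E : Set (V →₀ ℕ)) (k : ℕ) (a : V →₀ ℕ) : ℕ :=
  Nat.findGreatest (fun m => HasMatching E m a) k

theorem matchingOrder_le (E : Set (V →₀ ℕ)) (k : ℕ) (a : V →₀ ℕ) : matchingOrder E k a ≤ k := by
  classical
  exact Nat.findGreatest_le k

theorem hasMatching_matchingOrder (E : Set (V →₀ ℕ)) (k : ℕ) (a : V →₀ ℕ) :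
    HasMatching E (matchingOrder E k a) a := by
  classical
  exact Nat.findGreatest_spec (P := fun m => HasMatching E m a) (Nat.zero_le k)
    (hasMatching_zero E a)

theorem HasMatching.le_matchingOrder (h : HasMatching E m a) (hm : m ≤ k) :
    m ≤ matchingOrder E k a := by
  classical
  exact Nat.le_findGreatest hm h

theorem matchingOrder_le_of_forall
    (h : ∀ m ≤ k, HasMatching E m a → HasMatching E m b) :
    matchingOrder E k a ≤ matchingOrder E k b :=
  (h _ (matchingOrder_le E k a) (hasMatching_matchingOrder E k a)).le_matchingOrder
    (matchingOrder_le E k a)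

theorem matchingOrder_mono (E : Set (V →₀ ℕ)) (k : ℕ) : Monotone (matchingOrder E k) :=
  fun _ _ hab => matchingOrder_le_of_forall fun _ _ h => h.mono hab

theorem HasMatching.of_truncEqOn {S : Set V} (hE : ∀ e ∈ E, ∀ v, e v ≤ 1)
    (hES : ∀ e ∈ E, ∀ v ∉ S, e v = 0) (h : HasMatching E m a) (hm : m ≤ N)
    (hab : TruncEqOn N S a b) : HasMatching E m b := by
  obtain ⟨f, hf, hle⟩ := h
  refine ⟨f, hf, fun v => ?_⟩
  by_cases hv : v ∈ S
  · have hfm : (∑ i, f i) v ≤ m := by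
      rw [Finsupp.finsetSum_apply]
      exact (sum_le_card_nsmul _ _ 1 fun i _ => hE _ (hf i) v).trans_eq (by simp)
    have := hle v
    have := hab v hv
    omega
  · rw [Finsupp.finsetSum_apply, sum_eq_zero fun i _ => hES _ (hf i) v hv]
    exact Nat.zero_le _

theorem isLocal_matchingOrder {S : Set V} (hE : ∀ e ∈ E, ∀ v, e v ≤ 1)
    (hES : ∀ e ∈ E, ∀ v ∉ S, e v = 0) (k : ℕ) : IsLocal k S (matchingOrder E k) :=
  fun _ _ hab => le_antisymm
    (matchingOrder_le_of_forall fun _ hm h => h.of_truncEqOn hE hES hm hab)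
    (matchingOrder_le_of_forall fun _ hm h => h.of_truncEqOn hE hES hm hab.symm)

theorem hasMatching_iUnion_iff [Fintype ι] {E : ι → Set (V →₀ ℕ)} {c : V → ι}
    (hE : ∀ i, ∀ e ∈ E i, ∀ v ∉ c ⁻¹' {i}, e v = 0) :
    HasMatching (⋃ i, E i) k a ↔ k ≤ ∑ i, matchingOrder (E i) k a := by
  classical
  constructor
  · rintro ⟨f, hf, hle⟩
    choose p hp using fun j => Set.mem_iUnion.1 (hf j)
    have hfiber (i : ι) : #{j | p j = i} ≤ matchingOrder (E i) k a := by
      refine (hasMatching_card (f := f) (fun j hj => ?_) ?_).le_matchingOrder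
        ((card_filter_le _ _).trans_eq (card_fin k))
      · exact (mem_filter.1 hj).2 ▸ hp j
      · exact (sum_le_sum_of_subset (filter_subset _ _)).trans hle
    calc k = ∑ i, #{j | p j = i} :=
          (card_fin k).symm.trans (card_eq_sum_card_fiberwise fun _ _ => mem_univ _)
      _ ≤ ∑ i, matchingOrder (E i) k a := sum_le_sum fun i _ => hfiber i
  · intro hk
    choose f hf hle using fun i => hasMatching_matchingOrder (E i) k a
    refine HasMatching.anti ?_ hk
    have hsum : ∑ j : (i : ι) × Fin (matchingOrder (E i) k a), f j.1 j.2 ≤ a := fun v => by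
      rw [Fintype.sum_sigma, Finsupp.finsetSum_apply, sum_eq_single_of_mem (c v) (mem_univ _)]
      · exact hle (c v) v
      · intro i _ hi
        rw [Finsupp.finsetSum_apply]
        exact sum_eq_zero fun l _ => hE i _ (hf i l) v (Ne.symm hi)
    simpa using hasMatching_card (fun j _ => Set.mem_iUnion.2 ⟨j.1, hf j.1 j.2⟩) hsum

end MatchingOrder

section Konig

theorem exists_injective_of_card_le_card_biUnion_add {ι α : Type*} [Fintype ι] [DecidableEq α]
    {t : ι → Finset α} {d : ℕ} (h : ∀ s : Finset ι, #s ≤ #(s.biUnion t) + d) :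
    ∃ (L : Finset ι) (f : L → α), Function.Injective f ∧ (∀ i : L, f i ∈ t i) ∧
      Fintype.card ι ≤ #L + d := by
  classical
  -- Allowing `d` extra values for every index reduces this to Hall's theorem.
  let t' (i : ι) : Finset (α ⊕ Fin d) := (t i).disjSum univ
  have hall (s : Finset ι) : #s ≤ #(s.biUnion t') := by
    rcases s.eq_empty_or_nonempty with rfl | ⟨i₀, hi₀⟩
    · simp
    have hsub : (s.biUnion t).disjSum univ ⊆ s.biUnion t' := by
      intro q
      simp only [t', mem_biUnion, mem_disjSum]
      grind
    calc #s ≤ #((s.biUnion t).disjSum (univ : Finset (Fin d))) := by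
          simpa [card_disjSum] using h s
      _ ≤ #(s.biUnion t') := card_le_card hsub
  obtain ⟨g, hg, hgt⟩ := (all_card_le_biUnion_card_iff_exists_injective t').1 hall
  let L : Finset ι := {i | (g i).isLeft}
  have hL (i : L) : (g i).isLeft := (mem_filter.1 i.2).2
  have hcompl : #Lᶜ ≤ d := by
    have hinj : Set.InjOn g (Lᶜ : Finset ι) := hg.injOn
    refine (card_le_card_of_injOn (t := univ.map ⟨Sum.inr, Sum.inr_injective⟩) g
      (fun i hi => ?_) hinj).trans_eq (by simp)
    obtain ⟨n, hn⟩ := Sum.isRight_iff.1 (by simpa [L] using hi)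
    simp [hn]
  refine ⟨L, fun i => (g i).getLeft (hL i), fun i j hij => ?_, fun i => ?_, ?_⟩
  · refine Subtype.ext (hg ?_)
    rw [← Sum.inl_getLeft (g i) (hL i), ← Sum.inl_getLeft (g j) (hL j)]
    exact congrArg Sum.inl hij
  · have := hgt i
    rwa [← Sum.inl_getLeft (g i) (hL i), inl_mem_disjSum] at this
  · have := card_add_card_compl L
    omega

variable {V : Type*} {G : SimpleGraph V} {a : V →₀ ℕ}

theorem HasMatching.le_sum_isVertexCover {m : ℕ} (h : HasMatching (edgeExponents G) m a)
    {C : Finset V} (hC : G.IsVertexCover C) : m ≤ ∑ v ∈ C, a v := by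
  refine h.le_sum_of_forall_exists_mem ?_
  rintro _ ⟨v, w, hvw, rfl⟩
  rcases hC hvw with hv | hw
  · exact ⟨v, hv, by simp⟩
  · exact ⟨w, hw, by simp⟩

theorem mem_flatDirections_of_isVertexCover {S : Set V} {C : Finset V} (hC : G.IsVertexCover C)
    (hmatch : HasMatching (edgeExponents G) (∑ v ∈ C, a v) a) {v : V} (hvS : v ∈ S) (hvC : v ∉ C)
    (k : ℕ) : v ∈ flatDirections (matchingOrder (edgeExponents G) k) S a := by
  refine ⟨hvS, fun n => le_antisymm (matchingOrder_le_of_forall fun m _ h => ?_)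
    (matchingOrder_mono _ k le_self_add)⟩
  refine hmatch.anti ((h.le_sum_isVertexCover hC).trans_eq (sum_congr rfl fun w hw => ?_))
  rw [Finsupp.add_apply, Finsupp.single_eq_of_ne (ne_of_mem_of_not_mem hw hvC), add_zero]

theorem sum_add_le_sum_neighbors_add_sum [Fintype V] {X Y : Set V} (hXY : G.IsBipartiteWith X Y)
    {m : ℕ} (hm : ∀ C : Finset V, G.IsVertexCover C → m ≤ ∑ v ∈ C, a v) {T N : Finset V}
    (hN : ∀ v ∈ T, v ∈ X → ∀ w, G.Adj v w → w ∈ N) :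
    ∑ v ∈ T, a v + m ≤ ∑ w ∈ N, a w + ∑ v, a v := by
  classical
  have hcover : m ≤ ∑ v ∈ X.toFinset \ T ∪ N, a v := hm _ fun v w h => by
    have := hXY.mem_of_adj h
    have := h.symm
    simp only [coe_union, coe_sdiff, Set.coe_toFinset, Set.mem_union, Set.mem_sdiff, mem_coe]
    grind
  have hunion := sum_union_inter (s₁ := X.toFinset \ T) (s₂ := N) (f := a)
  have hdisj : ∑ v ∈ T, a v + ∑ v ∈ X.toFinset \ T, a v ≤ ∑ v, a v := by
    rw [← sum_union disjoint_sdiff]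
    exact sum_le_sum_of_subset (subset_univ _)
  omega

variable [Finite V]

theorem sum_single_le_of_injective {J : Type*} [Fintype J] {g : J → (v : V) × Fin (a v)}
    (hg : Function.Injective g) : ∑ j, Finsupp.single (g j).1 1 ≤ a := by
  classical
  have := Fintype.ofFinite V
  calc ∑ j, Finsupp.single (g j).1 1
      = ∑ p ∈ univ.map ⟨g, hg⟩, Finsupp.single p.1 1 := by rw [sum_map]; rfl
    _ ≤ ∑ p : (v : V) × Fin (a v), Finsupp.single p.1 1 := sum_le_sum_of_subset (subset_univ _)
    _ = a := by simp [Fintype.sum_sigma, Finsupp.univ_sum_single]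

theorem hasMatching_of_injective {J : Type*} [Fintype J] {p q : J → (v : V) × Fin (a v)}
    (hp : Function.Injective p) (hq : Function.Injective q) (hpq : ∀ i j, p i ≠ q j)
    (hadj : ∀ j, G.Adj (p j).1 (q j).1) : HasMatching (edgeExponents G) (Fintype.card J) a := by
  refine hasMatching_card (s := univ) (fun j _ => ⟨_, _, hadj j, rfl⟩) ?_
  rw [sum_add_distrib]
  exact (Fintype.sum_sum_type _).symm.trans_le (sum_single_le_of_injective (hp.sumElim hq hpq))

/-- A weighted form of Kőnig's theorem, obtained from Hall's theorem by replacing each vertex `v`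
by `a v` copies. -/
theorem hasMatching_of_forall_isVertexCover_le (hG : G.IsBipartite) {m : ℕ}
    (hm : ∀ C : Finset V, G.IsVertexCover C → m ≤ ∑ v ∈ C, a v) :
    HasMatching (edgeExponents G) m a := by
  classical
  have := Fintype.ofFinite V
  obtain ⟨X, Y, hXY⟩ := hG.exists_isBipartiteWith
  have hX {v w : V} (hv : v ∈ X) (h : G.Adj v w) : w ∉ X := fun hw =>
    Set.disjoint_left.1 hXY.disjoint hw (hXY.mem_of_mem_adj hv h)
  let t (p : (v : V) × Fin (a v)) : Finset ((v : V) × Fin (a v)) := {q | p.1 ∈ X ∧ G.Adj p.1 q.1}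
  have hdefect (s : Finset ((v : V) × Fin (a v))) : #s ≤ #(s.biUnion t) + (∑ v, a v - m) := by
    let T : Finset V := s.image Sigma.fst
    let N : Finset V := {w | ∃ v ∈ T, v ∈ X ∧ G.Adj v w}
    have hs : #s ≤ ∑ v ∈ T, a v := by
      have hsub : s ⊆ T.sigma fun _ => univ := fun p hp =>
        mem_sigma.2 ⟨mem_image_of_mem _ hp, mem_univ _⟩
      simpa using card_le_card hsub
    have hN : #(s.biUnion t) = ∑ w ∈ N, a w := by
      have : s.biUnion t = N.sigma fun _ => univ := by
        ext q
        simp [t, N, T]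
      simp [this]
    have := sum_add_le_sum_neighbors_add_sum hXY hm (T := T) (N := N) fun v hvT hvX w h =>
      mem_filter.2 ⟨mem_univ w, v, hvT, hvX, h⟩
    omega
  obtain ⟨L, f, hf, hft, hL⟩ := exists_injective_of_card_le_card_biUnion_add hdefect
  have hft (p : L) : p.1.1 ∈ X ∧ G.Adj p.1.1 (f p).1 := (mem_filter.1 (hft p)).2
  refine (hasMatching_of_injective Subtype.val_injective hf (fun p q hpq => ?_)
    fun p => (hft p).2).anti ?_
  · exact hX (hft q).1 (hft q).2 (hpq ▸ (hft p).1)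
  · have := hm univ (by simp)
    simp only [Fintype.card_sigma, Fintype.card_fin] at hL
    rw [Fintype.card_coe]
    omega

theorem exists_isVertexCover_hasMatching (hG : G.IsBipartite) (a : V →₀ ℕ) :
    ∃ C : Finset V, G.IsVertexCover C ∧ HasMatching (edgeExponents G) (∑ v ∈ C, a v) a := by
  classical
  have := Fintype.ofFinite V
  obtain ⟨C, hC, hmin⟩ := exists_min_image ({C | G.IsVertexCover C} : Finset (Finset V))
    (fun C => ∑ v ∈ C, a v) ⟨univ, by simp⟩
  simp only [mem_filter, mem_univ, true_and] at hC hmin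
  exact ⟨C, hC, hasMatching_of_forall_isVertexCover_le hG hmin⟩

-- Each vertex of an inclusion-minimal cover has a neighbor outside the cover.
theorem flatDirections_matchingOrder_nonempty (hG : G.IsBipartite) {S : Set V} (hS : S.Nonempty)
    (hadj : ∀ v w, G.Adj v w → w ∈ S) (k : ℕ) (a : V →₀ ℕ) :
    (flatDirections (matchingOrder (edgeExponents G) k) S a).Nonempty := by
  classical
  obtain ⟨C, ⟨hC, hmatch⟩, hmin⟩ :=
    exists_minimal_of_wellFoundedLT _ (exists_isVertexCover_hasMatching hG a)
  suffices ∃ v ∈ S, v ∉ C from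
    let ⟨v, hvS, hvC⟩ := this
    ⟨v, mem_flatDirections_of_isVertexCover hC hmatch hvS hvC k⟩
  obtain ⟨v, hv⟩ := hS
  by_cases hvC : v ∈ C
  · have hnot : ¬ G.IsVertexCover (C.erase v : Finset V) := fun h =>
      notMem_erase v C <| hmin
        ⟨h, hmatch.anti (sum_le_sum_of_subset (erase_subset v C))⟩ (erase_subset v C) hvC
    simp only [SimpleGraph.IsVertexCover, not_forall] at hnot
    obtain ⟨x, y, hxy, hcov⟩ := hnot
    have := hxy.ne
    have := hC hxy
    have := hadj x y hxy
    have := hadj y x hxy.symm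
    grind
  · exact ⟨v, hv, hvC⟩

end Konig

section Blocks

variable {V ι : Type*} {G : SimpleGraph V} {c : V → ι}

/-- The graph obtained from `G` by deleting all edges that do not join two vertices in `s`; the
vertices outside `s` are kept, so that its monomials live in the same polynomial ring. -/
def restrictEdges (G : SimpleGraph V) (s : Set V) : SimpleGraph V :=
  (G.induce s).spanningCoe

theorem restrictEdges_adj {s : Set V} {v w : V} :
    (restrictEdges G s).Adj v w ↔ G.Adj v w ∧ v ∈ s ∧ w ∈ s := by
  simp [restrictEdges]

theorem edgeExponents_eq_iUnion_restrictEdges (hc : ∀ v w, G.Adj v w → c v = c w) :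
    edgeExponents G = ⋃ i, edgeExponents (restrictEdges G (c ⁻¹' {i})) := by
  ext e
  rw [Set.mem_iUnion]
  constructor
  · rintro ⟨v, w, h, rfl⟩
    exact ⟨c v, v, w, restrictEdges_adj.2 ⟨h, rfl, (hc v w h).symm⟩, rfl⟩
  · rintro ⟨i, v, w, h, rfl⟩
    exact ⟨v, w, (restrictEdges_adj.1 h).1, rfl⟩

theorem apply_eq_zero_of_mem_edgeExponents_restrictEdges {s : Set V} {e : V →₀ ℕ}
    (he : e ∈ edgeExponents (restrictEdges G s)) {v : V} (hv : v ∉ s) : e v = 0 := by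
  by_contra hne
  obtain ⟨w, hvw⟩ := exists_adj_of_mem_edgeExponents he hne
  exact hv (restrictEdges_adj.1 hvw).2.1

theorem card_le_idealSdepth_edgeIdeal_pow (K : Type*) [Field K] [Finite V] [Fintype ι]
    (hc : ∀ v w, G.Adj v w → c v = c w) (hsurj : Function.Surjective c) {i₀ : ι}
    (hbip : ∀ i ≠ i₀, (G.induce (c ⁻¹' {i})).IsBipartite) (k : ℕ) :
    (Fintype.card ι : ℕ∞) ≤ idealSdepth (edgeIdeal K G ^ k) := by
  let E (i : ι) : Set (V →₀ ℕ) := edgeExponents (restrictEdges G (c ⁻¹' {i}))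
  have hE (i : ι) : ∀ e ∈ E i, ∀ v ∉ c ⁻¹' {i}, e v = 0 := fun e he v hv =>
    apply_eq_zero_of_mem_edgeExponents_restrictEdges he hv
  have hmem (f : MvPolynomial V K) :
      f ∈ edgeIdeal K G ^ k ↔ ∀ a ∈ f.support, k ≤ ∑ i, matchingOrder (E i) k a := by
    simp only [mem_edgeIdeal_pow_iff, edgeExponents_eq_iUnion_restrictEdges hc,
      hasMatching_iUnion_iff hE, E]
  have hloc (i : ι) : IsLocal k (c ⁻¹' {i}) (matchingOrder (E i) k) :=
    isLocal_matchingOrder (fun _ he => apply_le_one_of_mem_edgeExponents he) (hE i) k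
  have hflat (i : ι) (hi : i ≠ i₀) (a : V →₀ ℕ) :
      (flatDirections (matchingOrder (E i) k) (c ⁻¹' {i}) a).Nonempty :=
    flatDirections_matchingOrder_nonempty ((hbip i hi).map _) (hsurj i)
      (fun _ _ h => (restrictEdges_adj.1 h).2.2) k a
  obtain ⟨v₀, rfl⟩ := hsurj i₀
  exact le_idealSdepth_of_hasOrthantPartition hmem
    (hasOrthantPartition_le_sum k (fun i => matchingOrder_mono (E i) k) hloc hflat)

end Blocks

section BipartiteComponents

variable {V : Type*} {G : SimpleGraph V}

/-- The bipartite connected components of `G`. -/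
abbrev BipartiteComponent (G : SimpleGraph V) : Type _ :=
  {C : G.ConnectedComponent // C.toSimpleGraph.IsBipartite}

theorem card_bipartiteComponent [Fintype (BipartiteComponent G)] :
    Fintype.card (BipartiteComponent G) = numBipartiteComponents G :=
  Nat.card_eq_fintype_card.symm

open Classical in
/-- The coloring of the vertices of `G` that distinguishes the bipartite components and merges all
the other components into the single color `none`. -/
noncomputable def componentColor (G : SimpleGraph V) (v : V) : Option (BipartiteComponent G) :=
  if h : (G.connectedComponentMk v).toSimpleGraph.IsBipartite then some ⟨_, h⟩ else none

theorem componentColor_eq_some_iff {v : V} {C : BipartiteComponent G} :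
    componentColor G v = some C ↔ v ∈ C.1.supp := by
  rw [SimpleGraph.ConnectedComponent.mem_supp_iff, componentColor]
  have := C.2
  grind

theorem componentColor_eq_of_adj {v w : V} (h : G.Adj v w) :
    componentColor G v = componentColor G w := by
  rw [componentColor, componentColor,
    SimpleGraph.ConnectedComponent.connectedComponentMk_eq_of_adj h]

theorem componentColor_surjective (hG : ¬ G.IsBipartite) :
    Function.Surjective (componentColor G) := by
  rintro (_ | C)
  · obtain ⟨C, hC⟩ := not_forall.1 (mt SimpleGraph.colorable_iff_forall_connectedComponent.2 hG)
    obtain ⟨v, rfl⟩ := C.exists_rep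
    exact ⟨v, dif_neg hC⟩
  · obtain ⟨v, hv⟩ := C.1.nonempty_supp
    exact ⟨v, componentColor_eq_some_iff.2 hv⟩

theorem isBipartite_induce_componentColor_preimage {i : Option (BipartiteComponent G)}
    (hi : i ≠ none) :
    (G.induce (componentColor G ⁻¹' {i})).IsBipartite := by
  obtain ⟨C, rfl⟩ := Option.ne_none_iff_exists'.1 hi
  have : componentColor G ⁻¹' {some C} = C.1.supp :=
    Set.ext fun v => componentColor_eq_some_iff
  rw [this]
  exact C.2

end BipartiteComponents

end StanleyDepth

theorem corollary3p2 (K : Type*) [Field K] (V : Type*) [Finite V] (G : SimpleGraph V)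
    (hG : ¬ G.IsBipartite) (k : ℕ) (hk : 1 ≤ k) :
    ((StanleyDepth.numBipartiteComponents G + 1 : ℕ) : ℕ∞) ≤
      StanleyDepth.idealSdepth (StanleyDepth.edgeIdeal K G ^ k) := by
  open StanleyDepth in
  have := Fintype.ofFinite (BipartiteComponent G)
  rw [← card_bipartiteComponent, ← Fintype.card_option]
  exact card_le_idealSdepth_edgeIdeal_pow K (fun _ _ => componentColor_eq_of_adj)
    (componentColor_surjective hG) (fun _ => isBipartite_induce_componentColor_preimage) k
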